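/- Let $M$ be a matroid on a finite ground set $E$. Its base polytope $B(M)\subset\mathbb{R}^E$ is the convex hull of the indicator vectors $\sum_{e\in B}\chi_e$ of all bases $B$ of $M$. A lattice polytope $P\subset\mathbb{R}^E$ (the convex hull of a nonempty finite set of points of $\mathbb{Z}^E$) is called smooth if for every vertex $v$ of $P$ the primitive edge directions from $v$ (that is, the primitive vectors of $\mathbb{Z}^E$ that point from $v$ along the edges of $P$ containing $v$) are part of a $\mathbb{Z}$-basis of $\mathbb{Z}^E$. For $0\le r\le n$, let $U_{r,n}$ denote the uniform matroid on $n$ elements whose bases are exactly the $r$-element subsets. Theorem. The base polytope $B(M)$ is smooth if and only if $M$ is a direct sum of finitely many (possibly zero) matroids, each of which is a single loop, or isomorphic to a uniform matroid $U_{1,n}$ of rank one with $n\ge 1$, or isomorphic to a uniform matroid $U_{n-1,n}$ of corank one with $n\ge 1$. -/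

import Mathlib

noncomputable section

/-! ### Lattice polytopes in `ℝ^ι` and smoothness -/

namespace LatticePolytope

variable {ι : Type*}

/-- The lattice vector `u ∈ ℤ^ι`, seen as a vector in `ℝ^ι`. -/
def toReal (u : ι → ℤ) : ι → ℝ := fun i => (u i : ℝ)

/-- A lattice polytope is the convex hull of a nonempty finite set of lattice points. -/
def IsLatticePolytope (P : Set (ι → ℝ)) : Prop :=
  ∃ S : Set (ι → ℤ), S.Finite ∧ S.Nonempty ∧ P = convexHull ℝ (toReal '' S)

/-- An edge of `P` is a face of `P` of dimension one. A (nonempty) face is the set of points of `P`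
at which some linear functional attains its maximum over `P`. -/
def IsEdge (P F : Set (ι → ℝ)) : Prop :=
  F.Nonempty ∧ IsExposed ℝ P F ∧ Module.finrank ℝ (vectorSpan ℝ F) = 1

/-- A lattice vector is primitive if it is not a multiple of a lattice vector by a non-unit
integer; in particular it is nonzero. -/
def IsPrimitive (u : ι → ℤ) : Prop :=
  ∀ (k : ℤ) (w : ι → ℤ), u = k • w → IsUnit k

/-- The primitive edge directions of `P` from `v`: the primitive lattice vectors that point
from `v` along an edge of `P` containing `v`. -/
def edgeDirections (P : Set (ι → ℝ)) (v : ι → ℝ) : Set (ι → ℤ) :=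
  {u | IsPrimitive u ∧ ∃ F, IsEdge P F ∧ v ∈ F ∧ ∃ t : ℝ, 0 < t ∧ v + t • toReal u ∈ F}

/-- A lattice polytope is smooth if, for each of its vertices `v`, the primitive edge directions
from `v` are part of a `ℤ`-basis of the lattice `ℤ^ι`. -/
def IsSmooth (P : Set (ι → ℝ)) : Prop :=
  IsLatticePolytope P ∧
    ∀ v ∈ P.extremePoints ℝ, ∃ b : Module.Basis ι ℤ (ι → ℤ), edgeDirections P v ⊆ Set.range b

end LatticePolytope

/-! ### Matroids -/

namespace Matroid

variable {α : Type*}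

open Classical in
/-- The indicator vector in `ℝ^E` of a subset `B` of the ground set `E` of `M`. -/
def indicatorVector (M : Matroid α) (B : Set α) : M.E → ℝ :=
  fun e => if (e : α) ∈ B then 1 else 0

/-- The base polytope `B(M)`, in `ℝ^E`: the convex hull of the indicator vectors of the bases. -/
def basePolytope (M : Matroid α) : Set (M.E → ℝ) :=
  convexHull ℝ {x | ∃ B, M.IsBase B ∧ x = M.indicatorVector B}

/-- `N` is (a copy of) the uniform matroid `U_{r,n}`: its ground set has `n` elements and its bases
are exactly the subsets of the ground set that have `r` elements. -/
def IsUniform (N : Matroid α) (r n : ℕ) : Prop :=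
  N.E.encard = n ∧ ∀ B, N.IsBase B ↔ B ⊆ N.E ∧ B.encard = r

/-- `N` consists of a single loop. -/
def IsSingleLoop (N : Matroid α) : Prop :=
  ∃ e, N = Matroid.loopyOn {e}

end Matroid

end

/-! At the vertex of a base `B` the primitive edge directions are the vectors χ_f - χ_e for the
exchanges of e ∈ B by f ∉ B (`mem_edgeDirections_iff`), that is, the edges of a bipartite graph. A
4-cycle in this graph gives a linear relation, so smoothness forbids it
(`false_of_isSmooth_of_exchange_cycle`). A path of length three yields a 4-cycle at `B` or at a
neighbouring base, so it is forbidden too, and every component of the graph is a star.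

The components split the matroid into direct summands (`IsBase.eq_disjointSigma_restrict`). A star
centred in `B` is a summand of rank one, and a star centred outside `B` one of corank one.

Conversely, in such a direct sum the exchanges at any base form stars. The edge vectors of a star
forest extend to a lattice basis by a unimodular change of coordinates
(`exists_basis_of_idempotent`). -/

noncomputable section

namespace Matroid
variable {α : Type*}
open Set LatticePolytope

/-! ### Exchange graphs and direct sums -/

/-- The elements `e` and `f` can be exchanged at the base `B`. -/
def IsExchange (M : Matroid α) (B : Set α) (e f : α) : Prop :=
  e ∈ B ∧ f ∉ B ∧ M.IsBase (insert f (B \ {e}))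

lemma IsExchange.mem_ground {M : Matroid α} {B : Set α} {e f : α} (h : M.IsExchange B e f) :
    f ∈ M.E :=
  h.2.2.subset_ground (mem_insert _ _)

/-- The fundamental circuit of `e` over `B'` and the fundamental cocircuit of `e` at `B` share `e`.
A circuit and a cocircuit never meet in exactly one element, and any second common element serves as
`f`. -/
lemma IsBase.exists_symmetric_exchange {M : Matroid α} {B B' : Set α} {e : α} (hB : M.IsBase B)
    (hB' : M.IsBase B') (he : e ∈ B) (he' : e ∉ B') :
    ∃ f ∈ B' \ B, M.IsExchange B e f ∧ M.IsExchange B' f e := by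
  have heE := hB.subset_ground he
  have hC := hB'.fundCircuit_isCircuit heE he'
  have hK := fundCocircuit_isCocircuit he hB
  obtain ⟨f, ⟨hfC, hfK⟩, hfe⟩ := (hC.isCocircuit_inter_nontrivial hK
    ⟨e, mem_fundCircuit _ _ _, mem_fundCocircuit _ _ _⟩).exists_ne e
  have hfB' : f ∈ B' := by simpa [hfe] using M.fundCircuit_subset_insert e B' hfC
  have hfB : f ∉ B := by
    have := M.fundCocircuit_subset_insert_compl e B hfK
    simp only [hfe, mem_insert_iff, false_or] at this
    exact this.2
  have hfE := hB'.subset_ground hfB'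
  refine ⟨f, ⟨hfB', hfB⟩, ⟨he, hfB, ?_⟩, ⟨hfB', he', ?_⟩⟩
  · rw [hB.mem_fundCocircuit_iff_mem_fundCircuit,
      hB.indep.mem_fundCircuit_iff (by rwa [hB.closure_eq]) hfB] at hfK
    exact hB.exchange_isBase_of_indep hfB (by rwa [insert_sdiff_singleton_comm hfe])
  · rw [hB'.indep.mem_fundCircuit_iff (by rwa [hB'.closure_eq]) he'] at hfC
    exact hB'.exchange_isBase_of_indep he' (by rwa [insert_sdiff_singleton_comm hfe.symm])

/-- A path of length three in an exchange graph becomes a cycle of length four after pivoting on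
its middle edge. -/
lemma exists_exchange_cycle_of_path {M : Matroid α} {B : Set α} {e₁ e₂ f₁ f₂ : α}
    (hB : M.IsBase B) (h₁₁ : M.IsExchange B e₁ f₁) (h₁₂ : M.IsExchange B e₁ f₂)
    (h₂₂ : M.IsExchange B e₂ f₂) (he : e₁ ≠ e₂) (hf : f₁ ≠ f₂) :
    ∃ B a b c d, M.IsBase B ∧ a ≠ b ∧ c ≠ d ∧ M.IsExchange B a c ∧ M.IsExchange B a d ∧
      M.IsExchange B b c ∧ M.IsExchange B b d := by
  by_cases h₂₁ : M.IsExchange B e₂ f₁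
  · exact ⟨B, e₁, e₂, f₁, f₂, hB, he, hf, h₁₁, h₁₂, h₂₁, h₂₂⟩
  obtain ⟨he₁, hf₁, hb₁₁⟩ := h₁₁
  obtain ⟨-, hf₂, hb₁₂⟩ := h₁₂
  obtain ⟨he₂, -, hb₂₂⟩ := h₂₂
  have n₁₁ : e₁ ≠ f₁ := ne_of_mem_of_not_mem he₁ hf₁
  have n₁₂ : e₁ ≠ f₂ := ne_of_mem_of_not_mem he₁ hf₂
  have n₂₁ : e₂ ≠ f₁ := ne_of_mem_of_not_mem he₂ hf₁
  have n₂₂ : e₂ ≠ f₂ := ne_of_mem_of_not_mem he₂ hf₂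
  -- Only e₁ and f₂ can replace e₂ here, and e₁ would give the excluded exchange of e₂ by f₁.
  obtain ⟨x, ⟨hx, hx'⟩, hxb⟩ := hb₁₁.exchange hb₂₂ (e := e₂) (by simp [he.symm, he₂, n₂₂])
  have hxf : x = f₂ := by
    by_contra hxf
    have hxB : x ∈ B ∧ x ≠ e₂ := by simpa [hxf] using hx
    have hxe : x = e₁ := by
      by_contra hxe
      exact hx' (by simp [hxB.1, hxe])
    subst hxe
    refine h₂₁ ⟨he₂, hf₁, ?_⟩
    convert hxb using 1
    grind
  subst hxf
  -- At the base B - e₁ + f₂ the cycle joins {f₂, e₂} to {e₁, f₁}.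
  refine ⟨insert x (B \ {e₁}), x, e₂, e₁, f₁, hb₁₂, n₂₂.symm, n₁₁,
    ⟨by simp, by simp [n₁₂], ?_⟩, ⟨by simp, by simp [hf, hf₁], ?_⟩,
    ⟨by simp [he.symm, he₂], by simp [n₁₂], ?_⟩, ⟨by simp [he.symm, he₂], by simp [hf, hf₁], ?_⟩⟩
  · convert hB using 1; grind
  · convert hb₁₁ using 1; grind
  · convert hb₂₂ using 1; grind
  · convert hxb using 1; grind

/-- Each x ∈ S \ B is spanned by the rest of its fundamental circuit, whose elements are exactly
those exchangeable with x, hence lie in B ∩ S. -/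
lemma IsBase.subset_closure_inter_of_isExchange {M : Matroid α} {B S : Set α} (hB : M.IsBase B)
    (hSE : S ⊆ M.E) (hS : ∀ e f, M.IsExchange B e f → f ∈ S → e ∈ S) :
    S ⊆ M.closure (B ∩ S) := by
  intro x hx
  by_cases hxB : x ∈ B
  · exact M.mem_closure_of_mem ⟨hxB, hx⟩ (inter_subset_left.trans hB.subset_ground)
  have hC := hB.fundCircuit_isCircuit (hSE hx) hxB
  refine M.closure_subset_closure ?_ (hC.mem_closure_sdiff_singleton_of_mem (mem_fundCircuit _ _ _))
  rintro y ⟨hyC, hyx : y ≠ x⟩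
  have hyB : y ∈ B := by simpa [hyx] using M.fundCircuit_subset_insert x B hyC
  rw [hB.indep.mem_fundCircuit_iff (by rw [hB.closure_eq]; exact hSE hx) hxB] at hyC
  refine ⟨hyB, hS y x ⟨hyB, hxB, hB.exchange_isBase_of_indep hxB ?_⟩ hx⟩
  rwa [insert_sdiff_singleton_comm hyx.symm]

/-- If a base of `M` spans each part of a partition of the ground set, then `M` is the direct sum
of its restrictions to the parts. -/
lemma IsBase.eq_disjointSigma_restrict {M : Matroid α} [M.Finite] {ι : Type*} {S : ι → Set α}
    {B : Set α} (hB : M.IsBase B) (hdisj : Pairwise (Function.onFun Disjoint fun i => (M ↾ S i).E))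
    (hU : ⋃ i, S i = M.E) (hcl : ∀ i, S i ⊆ M.closure (B ∩ S i)) :
    M = Matroid.disjointSigma (fun i => M ↾ S i) hdisj := by
  have hSE i : S i ⊆ M.E := hU ▸ subset_iUnion S i
  have hind {I} (hI : M.Indep I) : (Matroid.disjointSigma (fun i => M ↾ S i) hdisj).Indep I := by
    rw [disjointSigma_indep_iff]
    refine ⟨fun i => ?_, by simpa [hU] using hI.subset_ground⟩
    simpa using hI.inter_right (S i)
  have hB' : (Matroid.disjointSigma (fun i => M ↾ S i) hdisj).IsBase B := by
    rw [disjointSigma_isBase_iff]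
    refine ⟨fun i => ?_, by simpa [hU] using hB.subset_ground⟩
    simp only [restrict_ground_eq]
    rw [isBase_restrict_iff (hSE i)]
    exact (hB.indep.inter_right (S i)).isBasis_of_subset_of_subset_closure inter_subset_right
      (hcl i)
  refine ext_isBase (by simp [hU]) fun A hA => ⟨fun hAb => ?_, fun hAb => ?_⟩
  -- `B` is a base of both matroids, so the two ranks agree and the inclusion of bases is an
  -- equality.
  · obtain ⟨A', hA', hAA'⟩ := (hind hAb.indep).exists_isBase_superset
    have hfin : A.Finite := M.ground_finite.subset hA
    rwa [hfin.eq_of_subset_of_encard_le hAA' (by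
      rw [hA'.encard_eq_encard_of_isBase hB', hB.encard_eq_encard_of_isBase hAb])]
  · have hsp : M.Spanning A := by
      rw [spanning_iff_ground_subset_closure hA, ← hU]
      refine iUnion_subset fun i => ?_
      have := (disjointSigma_isBase_iff.1 hAb).1 i
      simp only [restrict_ground_eq] at this
      rw [isBase_restrict_iff (hSE i)] at this
      exact this.subset_closure.trans (M.closure_subset_closure inter_subset_left)
    obtain ⟨A', hA', hAA'⟩ := hsp.exists_isBase_subset
    have hfin : A'.Finite := M.ground_finite.subset hA'.subset_ground
    rwa [← hfin.eq_of_subset_of_encard_le hAA' (by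
      rw [hAb.encard_eq_encard_of_isBase hB', hB.encard_eq_encard_of_isBase hA'])]

/-- If the exchange graph of `M` at `B` has no path of length three, then every component is
a star; the centre of the star is given by a function. -/
lemma exists_star_centre {M : Matroid α} {B : Set α}
    (hP : ∀ e₁ e₂ f₁ f₂, M.IsExchange B e₁ f₁ → M.IsExchange B e₁ f₂ → M.IsExchange B e₂ f₂ →
      e₁ = e₂ ∨ f₁ = f₂) :
    ∃ c : α → α, (∀ e f, M.IsExchange B e f → c e = c f) ∧
      (∀ x ∈ B, c x = x ∨ M.IsExchange B x (c x)) ∧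
      (∀ x ∉ B, c x = x ∨ M.IsExchange B (c x) x) := by
  classical
  -- A vertex of degree at least two is the centre of its star. A component that is a single edge is
  -- centred at its end in `B`, and an isolated vertex at itself.
  have key : ∀ x, ∃ y, (x ∈ B → (M.IsExchange B x y ∧ ∃ e, e ≠ x ∧ M.IsExchange B e y) ∨
        (y = x ∧ ∀ f e, M.IsExchange B x f → M.IsExchange B e f → e = x)) ∧
      (x ∉ B → (M.IsExchange B y x ∧ ∀ e, M.IsExchange B e x → e = y) ∨
        (y = x ∧ ∀ e, M.IsExchange B e x → ∃ e', e' ≠ e ∧ M.IsExchange B e' x)) := by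
    intro x
    by_cases hx : x ∈ B
    · by_cases h : ∃ f e, e ≠ x ∧ M.IsExchange B x f ∧ M.IsExchange B e f
      · obtain ⟨f, e, h⟩ := h
        exact ⟨f, by grind⟩
      · exact ⟨x, by grind⟩
    · by_cases h : ∃ e, M.IsExchange B e x ∧ ∀ e', M.IsExchange B e' x → e' = e
      · obtain ⟨e, h⟩ := h
        exact ⟨e, by grind⟩
      · exact ⟨x, by grind⟩
  choose c hcB hcN using key
  refine ⟨c, fun e f hef => ?_, fun x hx => ?_, fun x hx => ?_⟩
  · rcases hcB e hef.1 with ⟨h1, e', he', h2⟩ | ⟨h1, h2⟩ <;>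
    rcases hcN f hef.2.1 with ⟨h3, h4⟩ | ⟨h3, h4⟩
    · have := hP e e' f (c e) hef h1 h2
      grind
    · have := hP e e' f (c e) hef h1 h2
      grind
    · grind
    · grind
  · have := hcB x hx
    grind
  · have := hcN x hx
    grind


/-! ### Vertices and edges of the base polytope -/

open Classical in
/-- The lattice vector `χ_f - χ_e`. -/
def exchangeVector (M : Matroid α) (e f : M.E) : M.E → ℤ := Pi.single f 1 - Pi.single e 1

lemma exchangeVector_self_right {M : Matroid α} {e f : M.E} (h : e ≠ f) :
    M.exchangeVector e f f = 1 := by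
  simp [exchangeVector, h.symm]

lemma exchangeVector_self_left {M : Matroid α} {e f : M.E} (h : e ≠ f) :
    M.exchangeVector e f e = -1 := by
  simp [exchangeVector, h]

lemma exchangeVector_of_ne {M : Matroid α} {e f g : M.E} (h : g ≠ e) (h' : g ≠ f) :
    M.exchangeVector e f g = 0 := by
  simp [exchangeVector, h, h']

lemma isPrimitive_exchangeVector {M : Matroid α} {e f : M.E} (h : e ≠ f) :
    IsPrimitive (M.exchangeVector e f) := by
  intro k w hk
  have := congrFun hk f
  rw [exchangeVector_self_right h] at this
  exact IsUnit.of_mul_eq_one (w f) this.symm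

lemma indicatorVector_mem_basePolytope {M : Matroid α} {B : Set α} (hB : M.IsBase B) :
    M.indicatorVector B ∈ M.basePolytope :=
  subset_convexHull ℝ _ ⟨B, hB, rfl⟩

lemma basePolytope_subset {M : Matroid α} {K : Set (M.E → ℝ)} (hK : Convex ℝ K)
    (h : ∀ B, M.IsBase B → M.indicatorVector B ∈ K) : M.basePolytope ⊆ K :=
  convexHull_min (by rintro _ ⟨B, hB, rfl⟩; exact h B hB) hK

lemma finite_setOf_indicatorVector (M : Matroid α) [M.Finite] :
    {x | ∃ B, M.IsBase B ∧ x = M.indicatorVector B}.Finite := by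
  refine (M.ground_finite.finite_subsets.image M.indicatorVector).subset ?_
  rintro _ ⟨B, hB, rfl⟩
  exact ⟨B, hB.subset_ground, rfl⟩

lemma isLatticePolytope_basePolytope (M : Matroid α) [M.Finite] :
    IsLatticePolytope M.basePolytope := by
  classical
  obtain ⟨B, hB⟩ := M.exists_isBase
  let φ : Set α → M.E → ℤ := fun B e => if (e : α) ∈ B then 1 else 0
  have hφ (B : Set α) : toReal (φ B) = M.indicatorVector B := by
    ext e
    by_cases he : (e : α) ∈ B <;> simp [toReal, φ, indicatorVector, he]
  refine ⟨φ '' {B | M.IsBase B}, ?_, ⟨_, B, hB, rfl⟩, ?_⟩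
  · exact (M.ground_finite.finite_subsets.subset fun B hB => IsBase.subset_ground hB).image _
  · rw [basePolytope, image_image]
    congr 1
    ext x
    simp only [hφ, mem_image, mem_ofPred_eq, eq_comm]

lemma mem_Icc_of_mem_basePolytope {M : Matroid α} {x : M.E → ℝ} (hx : x ∈ M.basePolytope) :
    x ∈ Icc (0 : M.E → ℝ) 1 := by
  refine basePolytope_subset (convex_Icc _ _) (fun B _ => ⟨fun e => ?_, fun e => ?_⟩) hx <;>
  by_cases he : (e : α) ∈ B <;> simp [indicatorVector, he]

/-- The polytope lies in the unit cube, of which every 0/1 vector is already a vertex. -/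
lemma indicatorVector_mem_extremePoints {M : Matroid α} {B : Set α} (hB : M.IsBase B) :
    M.indicatorVector B ∈ M.basePolytope.extremePoints ℝ := by
  refine ⟨indicatorVector_mem_basePolytope hB, fun x hx y hy h => ?_⟩
  obtain ⟨a, b, ha, hb, hab, h⟩ := h
  have hx' := mem_Icc_of_mem_basePolytope hx
  have hy' := mem_Icc_of_mem_basePolytope hy
  ext e
  have hx0 : 0 ≤ x e := hx'.1 e
  have hx1 : x e ≤ 1 := hx'.2 e
  have hy0 : 0 ≤ y e := hy'.1 e
  have hy1 : y e ≤ 1 := hy'.2 e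
  have he := congrFun h e
  simp only [Pi.add_apply, Pi.smul_apply, smul_eq_mul] at he
  by_cases heB : (e : α) ∈ B <;> simp only [indicatorVector, heB, if_true, if_false] at he ⊢
  · nlinarith [mul_nonneg hb.le (sub_nonneg.2 hy1)]
  · nlinarith [mul_nonneg hb.le hy0]

lemma IsExchange.coe_ne {M : Matroid α} {B : Set α} {e f : M.E} (h : M.IsExchange B e f) :
    e ≠ f := by
  rintro rfl
  exact h.2.1 h.1

lemma IsExchange.indicatorVector_eq {M : Matroid α} {B : Set α} {e f : M.E}
    (h : M.IsExchange B e f) : M.indicatorVector (insert (f : α) (B \ {(e : α)})) =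
      M.indicatorVector B + toReal (M.exchangeVector e f) := by
  have hef := h.coe_ne
  ext g
  by_cases hge : g = e
  · subst hge
    simp [indicatorVector, toReal, exchangeVector_self_left hef, h.1, Subtype.coe_injective.ne hef]
  by_cases hgf : g = f
  · subst hgf
    simp [indicatorVector, toReal, exchangeVector_self_right hef, h.2.1]
  have hge' : (g : α) ≠ e := Subtype.coe_injective.ne hge
  have hgf' : (g : α) ≠ f := Subtype.coe_injective.ne hgf
  have hg : (g : α) ∈ insert (f : α) (B \ {(e : α)}) ↔ (g : α) ∈ B := by simp [hge', hgf']
  rw [Pi.add_apply, toReal, exchangeVector_of_ne hge hgf, Int.cast_zero, add_zero]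
  simp only [indicatorVector]
  split_ifs <;> simp_all

lemma sum_eq_of_mem_basePolytope {M : Matroid α} [Fintype M.E] {B : Set α} (hB : M.IsBase B)
    {x : M.E → ℝ} (hx : x ∈ M.basePolytope) : ∑ e, x e = ∑ e, M.indicatorVector B e := by
  classical
  have hcard {A : Set α} (hA : M.IsBase A) : ∑ e, M.indicatorVector A e = A.ncard := by
    simp only [indicatorVector, Finset.sum_boole]
    rw [← ncard_coe_finset, ← ncard_image_of_injective _ Subtype.coe_injective]
    congr 2
    ext e
    simpa using fun h => hA.subset_ground h
  have hconv : Convex ℝ {x : M.E → ℝ | ∑ e, x e = ∑ e, M.indicatorVector B e} := by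
    intro x hx y hy a b _ _ hab
    simp only [mem_ofPred_eq, Pi.add_apply, Pi.smul_apply, smul_eq_mul, Finset.sum_add_distrib,
      ← Finset.mul_sum] at hx hy ⊢
    rw [hx, hy, ← add_mul, hab, one_mul]
  refine basePolytope_subset hconv (fun A hA => ?_) hx
  rw [mem_ofPred_eq, hcard hA, hcard hB, hA.ncard_eq_ncard_of_isBase hB]

/-- The functional with weight 0 at e and f, 1 on the rest of `B` and -1 elsewhere is maximal at the
vertex of `B`. Its maximisers can differ from that vertex only at e and f, and the constant
coordinate sum confines them to a line. -/
lemma IsExchange.exists_isEdge {M : Matroid α} [M.Finite] {B : Set α} {e f : M.E}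
    (hB : M.IsBase B) (h : M.IsExchange B e f) : ∃ F, IsEdge M.basePolytope F ∧
      M.indicatorVector B ∈ F ∧ M.indicatorVector B + toReal (M.exchangeVector e f) ∈ F := by
  classical
  have : Fintype M.E := M.ground_finite.fintype
  have hef := h.coe_ne
  let w : M.E → ℝ := fun g => if g = e ∨ g = f then 0 else if (g : α) ∈ B then 1 else -1
  let l : StrongDual ℝ (M.E → ℝ) := ∑ g, w g • ContinuousLinearMap.proj g
  have hl (x : M.E → ℝ) : l x = ∑ g, w g * x g := by simp [l]
  set v := M.indicatorVector B with hv
  set u := toReal (M.exchangeVector e f) with hu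
  have hterm (x : M.E → ℝ) (hx : x ∈ M.basePolytope) (g : M.E) : w g * x g ≤ w g * v g := by
    have hx' := mem_Icc_of_mem_basePolytope hx
    have h0 : 0 ≤ x g := hx'.1 g
    have h1 : x g ≤ 1 := hx'.2 g
    simp only [w, hv, indicatorVector]
    split_ifs <;> linarith
  have hmax (x : M.E → ℝ) (hx : x ∈ M.basePolytope) : l x ≤ l v := by
    rw [hl, hl]
    exact Finset.sum_le_sum fun g _ => hterm x hx g
  have hlu : l (v + u) = l v := by
    rw [map_add, add_eq_left, hl]
    refine Finset.sum_eq_zero fun g _ => ?_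
    by_cases hge : g = e
    · simp [w, hge]
    by_cases hgf : g = f
    · simp [w, hgf]
    simp [hu, toReal, exchangeVector_of_ne hge hgf]
  have hvP := indicatorVector_mem_basePolytope hB
  have hvuP : v + u ∈ M.basePolytope := by
    rw [← h.indicatorVector_eq]
    exact indicatorVector_mem_basePolytope h.2.2
  have hvF : v ∈ l.toExposed M.basePolytope := ⟨hvP, hmax⟩
  have hvuF : v + u ∈ l.toExposed M.basePolytope := ⟨hvuP, by rwa [hlu]⟩
  have hu0 : u ≠ 0 := by
    intro h0
    have := congrFun h0 f
    simp [hu, toReal, exchangeVector_self_right hef] at this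
  have hline (x : M.E → ℝ) (hx : x ∈ l.toExposed M.basePolytope) : x -ᵥ v ∈ Submodule.span ℝ {u} := by
    have heq : ∀ g, w g * x g = w g * v g := by
      have h1 : l x = l v := le_antisymm (hmax x hx.1) (hx.2 v hvP)
      rw [hl, hl] at h1
      simpa using (Finset.sum_eq_sum_iff_of_le fun g _ => hterm x hx.1 g).1 h1
    have heq' : ∀ g, g ≠ e → g ≠ f → x g = v g := by
      intro g hge hgf
      refine mul_left_cancel₀ ?_ (heq g)
      simp only [w, hge, hgf, or_self, if_false]
      split_ifs <;> norm_num
    have hsum : ∑ g, (x g - v g) = 0 := by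
      rw [Finset.sum_sub_distrib, sum_eq_of_mem_basePolytope hB hx.1, sub_self]
    rw [Fintype.sum_eq_add e f hef fun g hg => by rw [heq' g hg.1 hg.2, sub_self]] at hsum
    refine Submodule.mem_span_singleton.2 ⟨x f - v f, ?_⟩
    ext g
    by_cases hge : g = e
    · subst hge
      simp only [Pi.smul_apply, hu, toReal, exchangeVector_self_left hef, smul_eq_mul, vsub_eq_sub,
        Pi.sub_apply]
      push_cast
      linarith
    by_cases hgf : g = f
    · subst hgf
      simp [hu, toReal, exchangeVector_self_right hef]
    simp [hu, toReal, exchangeVector_of_ne hge hgf, heq' g hge hgf]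
  refine ⟨_, ⟨⟨v, hvF⟩, ContinuousLinearMap.toExposed.isExposed, ?_⟩, hvF, hvuF⟩
  have : vectorSpan ℝ (l.toExposed M.basePolytope) = Submodule.span ℝ {u} := by
    refine le_antisymm ?_ ?_
    · rw [vectorSpan_eq_span_vsub_set_right ℝ hvF, Submodule.span_le]
      rintro _ ⟨x, hx, rfl⟩
      exact hline x hx
    · rw [Submodule.span_singleton_le_iff_mem]
      simpa using vsub_mem_vectorSpan ℝ hvuF hvF
  rw [this, finrank_span_singleton hu0]

/-- By Krein–Milman, a face whose only vertex is that of `B` would be a single point. -/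
lemma exists_isBase_of_mem_isExposed {M : Matroid α} [M.Finite] {B : Set α} {F : Set (M.E → ℝ)}
    (hF : IsExposed ℝ M.basePolytope F) {x : M.E → ℝ} (hx : x ∈ F)
    (hne : x ≠ M.indicatorVector B) :
    ∃ B', M.IsBase B' ∧ B' ≠ B ∧ M.indicatorVector B' ∈ F := by
  by_contra! hcon
  have hc : IsCompact M.basePolytope := M.finite_setOf_indicatorVector.isCompact_convexHull ℝ
  have hsub : F.extremePoints ℝ ⊆ {M.indicatorVector B} := by
    intro y hy
    have hy' : y ∈ M.basePolytope.extremePoints ℝ :=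
      hF.isExtreme.extremePoints_subset_extremePoints hy
    obtain ⟨A, hA, rfl⟩ := extremePoints_convexHull_subset hy'
    by_contra hAB
    exact hcon A hA (fun h => hAB (by rw [h]; rfl)) hy.1
  rw [← closure_convexHull_extremePoints (hF.isCompact hc) (hF.convex (convex_convexHull ℝ _))] at hx
  have := _root_.closure_mono (convexHull_mono hsub) hx
  simp only [convexHull_singleton, closure_singleton, mem_singleton_iff] at this
  exact hne this

/-- The edge contains the vertex of another base B'. A symmetric exchange between B and B' gives two
bases whose indicator vectors have the same sum as those of B and B', so a functional maximal at B
and B' is maximal at the new bases too. The exchange vector therefore spans the direction of the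
edge. -/
lemma exists_isExchange_of_mem_edgeDirections {M : Matroid α} [M.Finite] {B : Set α}
    (hB : M.IsBase B) {u : M.E → ℤ}
    (hu : u ∈ edgeDirections M.basePolytope (M.indicatorVector B)) :
    ∃ e f : M.E, M.IsExchange B e f ∧ u = M.exchangeVector e f := by
  obtain ⟨hprim, F, ⟨hne, hexp, hrank⟩, hvF, t, ht, hxF⟩ := hu
  have hu0 : u ≠ 0 := by
    rintro rfl
    exact not_isUnit_zero (hprim 0 0 (by simp))
  have htu : t • toReal u ≠ 0 := by
    obtain ⟨g, hg⟩ := Function.ne_iff.1 hu0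
    exact Function.ne_iff.2 ⟨g, by simpa [toReal, ht.ne'] using hg⟩
  obtain ⟨B', hB', hBB', hB'F⟩ := exists_isBase_of_mem_isExposed (B := B) hexp hxF (by simpa using htu)
  obtain ⟨e, he, he'⟩ := not_subset.1 fun h => hBB' (hB.eq_of_subset_isBase hB' h).symm
  obtain ⟨f, hf, hex, hex'⟩ := hB.exists_symmetric_exchange hB' he he'
  lift e to M.E using hB.subset_ground he
  lift f to M.E using hex.mem_ground
  have hef := hex.coe_ne
  have hFP := hexp.subset
  have hwF : M.indicatorVector B + toReal (M.exchangeVector e f) ∈ F := by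
    obtain ⟨l, hl⟩ := hexp hne
    have h1 := indicatorVector_mem_basePolytope hex.2.2
    have h2 := indicatorVector_mem_basePolytope hex'.2.2
    rw [hex.indicatorVector_eq] at h1
    rw [hex'.indicatorVector_eq] at h2
    have hneg : toReal (M.exchangeVector f e) = -toReal (M.exchangeVector e f) := by
      ext g
      simp [toReal, exchangeVector]
    rw [hl] at hvF hB'F ⊢
    have h3 := hB'F.2 _ h2
    refine ⟨h1, fun y hy => (hvF.2 y hy).trans ?_⟩
    rw [map_add, hneg, map_neg] at h3
    rw [map_add]
    linarith
  have hw0 : toReal (M.exchangeVector e f) ≠ 0 :=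
    Function.ne_iff.2 ⟨f, by simp [toReal, exchangeVector_self_right hef]⟩
  have hmem : ∀ z, M.indicatorVector B + z ∈ F → z ∈ vectorSpan ℝ F := fun z hz => by
    simpa using vsub_mem_vectorSpan ℝ hz hvF
  obtain ⟨c, hc⟩ := (finrank_eq_one_iff_of_nonzero' (⟨_, hmem _ hwF⟩ : vectorSpan ℝ F)
    (by simpa using hw0)).1 hrank ⟨_, hmem _ hxF⟩
  replace hc : c • toReal (M.exchangeVector e f) = t • toReal u := congrArg Subtype.val hc
  have hcf : c = t * u f := by
    simpa [toReal, exchangeVector_self_right hef] using congrFun hc f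
  have huk : u = u f • M.exchangeVector e f := by
    ext g
    have hg := congrFun hc g
    simp only [toReal, Pi.smul_apply, smul_eq_mul, hcf, mul_assoc] at hg
    have := mul_left_cancel₀ ht.ne' hg
    exact_mod_cast this.symm
  -- Since f ∉ B, the coordinate at f starts at 0 and cannot decrease inside the cube; this fixes
  -- the sign of `u`.
  have hpos : 0 ≤ u f := by
    have h0 : (0 : ℝ) ≤ _ := (mem_Icc_of_mem_basePolytope (hFP hxF)).1 f
    have hB0 : M.indicatorVector B f = 0 := by simp [indicatorVector, hf.2]
    simp only [Pi.add_apply, hB0, zero_add, Pi.smul_apply, smul_eq_mul, toReal] at h0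
    exact_mod_cast nonneg_of_mul_nonneg_right h0 ht
  have hu1 : u f = 1 := by
    rcases Int.isUnit_iff.1 (hprim _ _ huk) with h | h
    · exact h
    · omega
  rw [hu1, one_smul] at huk
  exact ⟨e, f, hex, huk⟩

/-- The primitive edge directions of the base polytope at the vertex of a base `B` are the vectors
`χ_f - χ_e` given by the exchanges at `B`. -/
lemma mem_edgeDirections_iff {M : Matroid α} [M.Finite] {B : Set α} (hB : M.IsBase B)
    {u : M.E → ℤ} : u ∈ edgeDirections M.basePolytope (M.indicatorVector B) ↔
      ∃ e f : M.E, M.IsExchange B e f ∧ u = M.exchangeVector e f := by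
  refine ⟨exists_isExchange_of_mem_edgeDirections hB, ?_⟩
  rintro ⟨e, f, h, rfl⟩
  obtain ⟨F, hF, hv, hu⟩ := h.exists_isEdge hB
  exact ⟨isPrimitive_exchangeVector h.coe_ne, F, hF, hv, 1, one_pos, by simpa using hu⟩


/-! ### Lattice bases and the obstruction to smoothness -/

open Classical in
/-- The lattice vectors `±(χ_x - χ_{c x})`, for an idempotent map `c` and the points `x` that it
moves, are part of a basis of the lattice. -/
lemma exists_basis_of_idempotent {ι : Type*} [Finite ι] (c : ι → ι) (hc : ∀ x, c (c x) = c x)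
    (s : ι → ℤˣ) : ∃ b : Module.Basis ι ℤ (ι → ℤ),
      ∀ x, c x ≠ x → b x = s x • (Pi.single x 1 - Pi.single (c x) 1 : ι → ℤ) := by
  have := Fintype.ofFinite ι
  let p := Pi.basisFun ℤ ι
  have hp (x : ι) : p x = Pi.single x 1 := Pi.basisFun_apply ℤ ι x
  -- By idempotence both maps fix the basis vector at `c x`, which makes them mutually inverse.
  let T := p.constr ℤ fun x => if c x = x then p x else s x • (p x - p (c x))
  let S := p.constr ℤ fun x => if c x = x then p x else s x • p x + p (c x)
  have hT (x : ι) : T (p x) = if c x = x then p x else s x • (p x - p (c x)) :=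
    p.constr_basis ℤ _ x
  have hS (x : ι) : S (p x) = if c x = x then p x else s x • p x + p (c x) :=
    p.constr_basis ℤ _ x
  have hu (u : ℤˣ) (f : (ι → ℤ) →ₗ[ℤ] (ι → ℤ)) (y : ι → ℤ) : f (u • y) = u • f y :=
    f.map_smul (u : ℤ) y
  have hTS : T ∘ₗ S = LinearMap.id := p.ext fun x => by
    by_cases hx : c x = x
    · simp [hS, hT, hx]
    · simp [hS, hT, hx, hc, hu, smul_smul]
  have hST : S ∘ₗ T = LinearMap.id := p.ext fun x => by
    by_cases hx : c x = x
    · simp [hS, hT, hx]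
    · simp [hS, hT, hx, hc, hu, smul_smul]
  refine ⟨p.map (LinearEquiv.ofLinearMap T S hTS hST), fun x hx => ?_⟩
  simp [hT, hx, ← hp]

/-- The relation (χ_c - χ_a) + (χ_d - χ_b) = (χ_d - χ_a) + (χ_c - χ_b) cannot hold among members of
a basis. -/
lemma false_of_isSmooth_of_exchange_cycle {M : Matroid α} [M.Finite]
    (hM : IsSmooth M.basePolytope) {B : Set α} (hB : M.IsBase B) {a b c d : α} (hab : a ≠ b)
    (hcd : c ≠ d) (hac : M.IsExchange B a c) (had : M.IsExchange B a d)
    (hbc : M.IsExchange B b c) (hbd : M.IsExchange B b d) : False := by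
  lift a to M.E using hB.subset_ground hac.1
  lift b to M.E using hB.subset_ground hbc.1
  lift c to M.E using hac.mem_ground
  lift d to M.E using had.mem_ground
  obtain ⟨p, hp⟩ := hM.2 _ (indicatorVector_mem_extremePoints hB)
  have hmem {e f : M.E} (h : M.IsExchange B e f) : ∃ i, p i = M.exchangeVector e f :=
    hp ((mem_edgeDirections_iff hB).2 ⟨e, f, h, rfl⟩)
  obtain ⟨i, hi⟩ := hmem hac
  obtain ⟨j, hj⟩ := hmem hbd
  obtain ⟨k, hk⟩ := hmem had
  obtain ⟨l, hl⟩ := hmem hbc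
  have hik : k ≠ i := by
    rintro rfl
    have := congrFun (hi.symm.trans hk) c
    rw [exchangeVector_self_right hac.coe_ne, exchangeVector_of_ne hac.coe_ne.symm
      fun h => hcd (by rw [h])] at this
    exact one_ne_zero this
  have hil : l ≠ i := by
    rintro rfl
    have := congrFun (hi.symm.trans hl) a
    rw [exchangeVector_self_left hac.coe_ne, exchangeVector_of_ne (fun h => hab (by rw [h]))
      hac.coe_ne] at this
    norm_num at this
  have hsum : p i + p j = p k + p l := by
    rw [hi, hj, hk, hl]
    simp only [exchangeVector]
    abel
  -- The coefficient of `p i` is at least 1 on the left, whether or not i = j, and 0 on the right.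
  have := congrArg (fun v => p.repr v i) hsum
  simp only [map_add, Module.Basis.repr_self, Finsupp.add_apply, Finsupp.single_eq_same,
    Finsupp.single_eq_of_ne hik.symm, Finsupp.single_eq_of_ne hil.symm] at this
  have hj0 : 0 ≤ (Finsupp.single j (1 : ℤ)) i := by
    classical
    rw [Finsupp.single_apply]
    split_ifs <;> norm_num
  omega

/-! ### From smoothness to the decomposition -/

lemma isUniform_one_of_singleton_isBase {N : Matroid α} [N.Finite] {z : α} (hz : N.IsBase {z})
    (h : ∀ x ∈ N.E, N.Indep {x}) : ∃ n : ℕ, 1 ≤ n ∧ N.IsUniform 1 n := by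
  have hfin := N.ground_finite
  refine ⟨N.E.ncard, ?_, hfin.cast_ncard_eq.symm, fun B => ⟨fun hB => ⟨hB.subset_ground, ?_⟩, ?_⟩⟩
  · exact (ncard_pos hfin).2 ⟨z, hz.subset_ground rfl⟩
  · rw [hB.encard_eq_encard_of_isBase hz]
    simp
  · rintro ⟨hBE, hB⟩
    obtain ⟨x, rfl⟩ := encard_eq_one.1 (by simpa using hB)
    obtain ⟨B', hB', hxB'⟩ := (h x (hBE rfl)).exists_isBase_superset
    rwa [(finite_singleton x).eq_of_subset_of_encard_le hxB'
      (by rw [hB'.encard_eq_encard_of_isBase hz]; simp)]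

lemma isUniform_sub_one_of_sdiff_isBase {N : Matroid α} [N.Finite] {z : α} (hz : z ∈ N.E)
    (h : ∀ x ∈ N.E, N.IsBase (N.E \ {x})) : ∃ n : ℕ, 1 ≤ n ∧ N.IsUniform (n - 1) n := by
  have hfin := N.ground_finite
  have hcard {x : α} (hx : x ∈ N.E) : (N.E \ {x}).encard = (N.E.ncard - 1 : ℕ) := by
    rw [← (hfin.subset sdiff_subset).cast_ncard_eq, ncard_sdiff_singleton_of_mem hx]
  refine ⟨N.E.ncard, (ncard_pos hfin).2 ⟨z, hz⟩, hfin.cast_ncard_eq.symm,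
    fun B => ⟨fun hB => ⟨hB.subset_ground, ?_⟩, ?_⟩⟩
  · rw [hB.encard_eq_encard_of_isBase (h z hz), hcard hz]
  · rintro ⟨hBE, hB⟩
    have hne : B ≠ N.E := by
      rintro rfl
      rw [← hfin.cast_ncard_eq, Nat.cast_inj] at hB
      have := (ncard_pos hfin).2 ⟨z, hz⟩
      omega
    obtain ⟨x, hx, hxB⟩ := exists_of_ssubset (hBE.ssubset_of_ne hne)
    rw [(hfin.subset hBE).eq_of_subset_of_encard_le
      (subset_sdiff_singleton hBE hxB) (by rw [hB, hcard hx])]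
    exact h x hx

/-- A matroid with smooth base polytope decomposes as a direct sum. -/
lemma exists_eq_disjointSigma_of_isSmooth {M : Matroid α} [M.Finite]
    (hM : IsSmooth M.basePolytope) : ∃ (k : ℕ) (N : Fin k → Matroid α)
      (hN : Pairwise (Function.onFun Disjoint fun i => (N i).E)),
      M = Matroid.disjointSigma N hN ∧
      ∀ i, (∃ n : ℕ, 1 ≤ n ∧ (N i).IsUniform 1 n) ∨
        (∃ n : ℕ, 1 ≤ n ∧ (N i).IsUniform (n - 1) n) := by
  obtain ⟨B, hB⟩ := M.exists_isBase
  have hP (e₁ e₂ f₁ f₂) (h₁₁ : M.IsExchange B e₁ f₁) (h₁₂ : M.IsExchange B e₁ f₂)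
      (h₂₂ : M.IsExchange B e₂ f₂) : e₁ = e₂ ∨ f₁ = f₂ := by
    by_contra! hne
    obtain ⟨B', a, b, c, d, hB', hab, hcd, h⟩ :=
      exists_exchange_cycle_of_path hB h₁₁ h₁₂ h₂₂ hne.1 hne.2
    exact false_of_isSmooth_of_exchange_cycle hM hB' hab hcd h.1 h.2.1 h.2.2.1 h.2.2.2
  obtain ⟨c, hc, hcB, hcN⟩ := exists_star_centre hP
  have := (M.ground_finite.image c).to_subtype
  obtain ⟨k, ⟨φ⟩⟩ := Finite.exists_equiv_fin (c '' M.E)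
  -- The parts are the fibres of the centre map, that is, the components of the exchange graph.
  let S (i : Fin k) : Set α := {x ∈ M.E | c x = φ.symm i}
  have hSE i : S i ⊆ M.E := sep_subset _ _
  have hU : ⋃ i, S i = M.E := by
    refine (iUnion_subset hSE).antisymm fun x hx => mem_iUnion.2 ⟨φ ⟨c x, x, hx, rfl⟩, hx, ?_⟩
    rw [φ.symm_apply_apply]
  have hdisj : Pairwise (Function.onFun Disjoint fun i => (M ↾ S i).E) := by
    refine fun i j hij => disjoint_left.2 fun x hxi hxj => hij ?_
    exact φ.symm.injective (Subtype.ext (hxi.2.symm.trans hxj.2))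
  have hcl (i : Fin k) : S i ⊆ M.closure (B ∩ S i) :=
    hB.subset_closure_inter_of_isExchange (hSE i) fun e f hef hf =>
      ⟨hB.subset_ground hef.1, (hc e f hef).trans hf.2⟩
  have hbase (i : Fin k) : (M ↾ S i).IsBase (B ∩ S i) := by
    rw [isBase_restrict_iff (hSE i)]
    exact (hB.indep.inter_right (S i)).isBasis_of_subset_of_subset_closure inter_subset_right
      (hcl i)
  refine ⟨k, _, hdisj, hB.eq_disjointSigma_restrict hdisj hU hcl, fun i => ?_⟩
  have hfin : (M ↾ S i).Finite := ⟨M.ground_finite.subset (hSE i)⟩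
  obtain ⟨z, hz⟩ : ∃ z, z = (φ.symm i : α) := ⟨_, rfl⟩
  have hzS : z ∈ S i := by
    obtain ⟨x, hx, hxz⟩ := (φ.symm i).2
    rw [← hz] at hxz
    have hcz : c z = z := by
      by_cases hxB : x ∈ B
      · rcases hcB x hxB with h | h
        · rwa [← hxz, h]
        · rw [← hxz, ← hc _ _ h]
      · rcases hcN x hxB with h | h
        · rwa [← hxz, h]
        · rw [← hxz, hc _ _ h]
    refine ⟨?_, hcz.trans hz⟩
    by_cases hxB : x ∈ B
    · rcases hcB x hxB with h | h
      · rwa [← hxz, h]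
      · exact hxz ▸ h.mem_ground
    · rcases hcN x hxB with h | h
      · rwa [← hxz, h]
      · exact hxz ▸ hB.subset_ground h.1
  have hmem (x : α) (hx : x ∈ S i) : c x = z := hx.2.trans hz.symm
  -- A centre in `B` is all that its part has in common with `B`: rank one. A centre outside `B` is
  -- all that its part lacks: corank one.
  by_cases hzB : z ∈ B
  · left
    have hBS : B ∩ S i = {z} := by
      refine subset_antisymm ?_ (singleton_subset_iff.2 ⟨hzB, hzS⟩)
      rintro x ⟨hxB, hxS⟩
      have := hmem x hxS
      rcases hcB x hxB with h | h
      · exact h.symm.trans this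
      · exact (h.2.1 (this ▸ hzB)).elim
    refine isUniform_one_of_singleton_isBase (hBS ▸ hbase i) fun x hx => ?_
    rw [restrict_indep_iff]
    refine ⟨?_, singleton_subset_iff.2 hx⟩
    by_cases hxB : x ∈ B
    · exact hB.indep.subset (singleton_subset_iff.2 hxB)
    rcases hcN x hxB with h | h
    · rw [hmem x hx] at h
      exact (hxB (h ▸ hzB)).elim
    · exact h.2.2.indep.subset (singleton_subset_iff.2 (mem_insert _ _))
  · right
    have hSB (x : α) (hx : x ∈ S i) (hxz : x ≠ z) : M.IsExchange B x z := by
      by_cases hxB : x ∈ B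
      · rcases hcB x hxB with h | h
        · exact (hxz (h.symm.trans (hmem x hx))).elim
        · rwa [hmem x hx] at h
      · rcases hcN x hxB with h | h
        · exact (hxz (h.symm.trans (hmem x hx))).elim
        · rw [hmem x hx] at h
          exact (hzB h.1).elim
    have hBS : B ∩ S i = S i \ {z} := by
      ext x
      refine ⟨fun hx => ⟨hx.2, fun h => hzB (h ▸ hx.1)⟩, fun hx => ⟨(hSB x hx.1 hx.2).1, hx.1⟩⟩
    refine isUniform_sub_one_of_sdiff_isBase (z := z) hzS fun x hx => ?_
    rw [restrict_ground_eq] at hx ⊢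
    have hbz := hBS ▸ hbase i
    by_cases hxz : x = z
    · rwa [hxz]
    have hind : (M ↾ S i).Indep (S i \ {x}) := by
      rw [restrict_indep_iff]
      refine ⟨(hSB x hx hxz).2.2.indep.subset fun y hy => ?_, sdiff_subset⟩
      by_cases hyz : y = z
      · exact Or.inl hyz
      · exact Or.inr ⟨(hSB y hy.1 hyz).1, hy.2⟩
    obtain ⟨A, hA, hxA⟩ := hind.exists_isBase_superset
    have hAfin := hfin.ground_finite.subset hA.subset_ground
    rwa [(hAfin.subset hxA).eq_of_subset_of_encard_le hxA]
    rw [hA.encard_eq_encard_of_isBase hbz, encard_sdiff_singleton_of_mem hx,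
      encard_sdiff_singleton_of_mem hzS]

/-! ### From the decomposition to smoothness -/

/-- At each base of a loop or of a uniform matroid of rank or corank one, the exchanges involve a
fixed element. -/
lemma exists_centre_of_isBase {N : Matroid α} (hN : N.IsSingleLoop ∨
      (∃ n : ℕ, 1 ≤ n ∧ N.IsUniform 1 n) ∨ (∃ n : ℕ, 1 ≤ n ∧ N.IsUniform (n - 1) n))
    {B : Set α} (hB : N.IsBase B) : ∃ z ∈ N.E, ∃ s : ℤˣ, ∀ e ∈ B, ∀ f ∈ N.E, f ∉ B →
      (e = z ∧ s = 1) ∨ (f = z ∧ s = -1) := by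
  rcases hN with ⟨x, rfl⟩ | ⟨n, hn, hE, hb⟩ | ⟨n, hn, hE, hb⟩
  -- The base of a loop is empty, so the sign is arbitrary. In general it is 1 for a centre inside
  -- the base and -1 for one outside.
  · refine ⟨x, rfl, 1, fun e he => ?_⟩
    rw [loopyOn_isBase_iff] at hB
    simp [hB] at he
  · obtain ⟨hBE, hB1⟩ := (hb B).1 hB
    obtain ⟨z, rfl⟩ := encard_eq_one.1 (by simpa using hB1)
    exact ⟨z, hBE rfl, 1, fun e he _ _ _ => Or.inl ⟨he, rfl⟩⟩
  · obtain ⟨hBE, hB1⟩ := (hb B).1 hB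
    have hEfin : N.E.Finite := finite_of_encard_eq_coe hE
    have h1 : (N.E \ B).encard = 1 := by
      rw [← (hEfin.subset sdiff_subset).cast_ncard_eq, ncard_sdiff hBE (hEfin.subset hBE)]
      rw [← hEfin.cast_ncard_eq, Nat.cast_inj] at hE
      rw [← (hEfin.subset hBE).cast_ncard_eq, Nat.cast_inj] at hB1
      rw [hE, hB1, Nat.sub_sub_self hn, Nat.cast_one]
    obtain ⟨z, hz⟩ := encard_eq_one.1 h1
    refine ⟨z, (hz.symm.subset rfl).1, -1, fun e _ f hf hfB => Or.inr ⟨?_, rfl⟩⟩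
    exact hz.subset ⟨hf, hfB⟩

/-- Every base meets a summand in a base of it. An exchange that removed `e` from a summand without
adding `f` to it would leave a base properly inside another. -/
lemma IsExchange.mem_part {ι : Type*} {N : ι → Matroid α}
    {hN : Pairwise (Function.onFun Disjoint fun i => (N i).E)} {B : Set α}
    (hB : (Matroid.disjointSigma N hN).IsBase B) {e f : α}
    (h : (Matroid.disjointSigma N hN).IsExchange B e f) {i : ι} (hi : e ∈ (N i).E) :
    f ∈ (N i).E := by
  by_contra hf
  have h1 := (disjointSigma_isBase_iff.1 hB).1 i
  have h2 := (disjointSigma_isBase_iff.1 h.2.2).1 i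
  rw [insert_inter_of_notMem hf] at h2
  have := h2.eq_of_subset_isBase h1 (inter_subset_inter_left _ sdiff_subset)
  exact (this.symm.subset ⟨h.1, hi⟩).1.2 rfl

/-- At each vertex, every edge direction is ±(χ_x - χ_z) with z the chosen centre of the summand
containing x. The map from x to z is idempotent, since z lies in the same summand. -/
lemma isSmooth_basePolytope_disjointSigma {ι : Type*} (N : ι → Matroid α)
    (hN : Pairwise (Function.onFun Disjoint fun i => (N i).E))
    [hfin : (Matroid.disjointSigma N hN).Finite]
    (h : ∀ i, (N i).IsSingleLoop ∨ (∃ n : ℕ, 1 ≤ n ∧ (N i).IsUniform 1 n) ∨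
      (∃ n : ℕ, 1 ≤ n ∧ (N i).IsUniform (n - 1) n)) :
    IsSmooth (Matroid.disjointSigma N hN).basePolytope := by
  refine ⟨isLatticePolytope_basePolytope _, fun v hv => ?_⟩
  obtain ⟨B, hB, rfl⟩ := extremePoints_convexHull_subset hv
  have : Finite (Matroid.disjointSigma N hN).E := hfin.ground_finite.to_subtype
  have hpart (x : (Matroid.disjointSigma N hN).E) : ∃ i, (x : α) ∈ (N i).E := by
    simpa using x.2
  choose q hq using hpart
  have hq' {i} {x : (Matroid.disjointSigma N hN).E} (hx : (x : α) ∈ (N i).E) : q x = i := by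
    by_contra hne
    exact disjoint_left.1 (hN hne) (hq x) hx
  choose z hzE s hs using fun i => exists_centre_of_isBase (h i) ((disjointSigma_isBase_iff.1 hB).1 i)
  let c (x : (Matroid.disjointSigma N hN).E) : (Matroid.disjointSigma N hN).E :=
    ⟨z (q x), by simpa using ⟨_, hzE (q x)⟩⟩
  obtain ⟨b, hb⟩ := exists_basis_of_idempotent c
    (fun x => by simp only [c]; congr 2; exact hq' (hzE _)) fun x => s (q x)
  refine ⟨b, fun u hu => ?_⟩
  obtain ⟨e, f, hef, rfl⟩ := (mem_edgeDirections_iff hB).1 hu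
  have hfe : q f = q e := hq' (hef.mem_part hB (hq e))
  have hne := hef.coe_ne
  rcases hs (q e) e ⟨hef.1, hq e⟩ f (hfe ▸ hq f) (fun hf => hef.2.1 hf.1) with ⟨hz, h1⟩ | ⟨hz, h1⟩
  · have hcf : c f = e := Subtype.ext (by simp only [c, hfe, hz])
    refine ⟨f, ?_⟩
    rw [hb f (by rwa [hcf]), hcf, hfe, h1, one_smul, exchangeVector]
    congr!
  · have hce : c e = f := Subtype.ext (by simp only [c, hz])
    refine ⟨e, ?_⟩
    rw [hb e (by rw [hce]; exact hne.symm), hce, h1, Units.neg_smul, one_smul, neg_sub,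
      exchangeVector]
    congr!

end Matroid
end

theorem mainTheorem2 {α : Type*} (M : Matroid α) [M.Finite] :
    LatticePolytope.IsSmooth M.basePolytope ↔
      ∃ (k : ℕ) (N : Fin k → Matroid α)
        (hN : Pairwise (Function.onFun Disjoint fun i => (N i).E)),
        M = Matroid.disjointSigma N hN ∧
        ∀ i, (N i).IsSingleLoop ∨
          (∃ n : ℕ, 1 ≤ n ∧ (N i).IsUniform 1 n) ∨
          (∃ n : ℕ, 1 ≤ n ∧ (N i).IsUniform (n - 1) n) := by
  constructor
  · intro h
    obtain ⟨k, N, hN, hM, hU⟩ := Matroid.exists_eq_disjointSigma_of_isSmooth h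
    -- A single loop is U_{0,1}, so it already occurs among the summands of corank one.
    exact ⟨k, N, hN, hM, fun i => Or.inr (hU i)⟩
  · rintro ⟨k, N, hN, rfl, hU⟩
    exact Matroid.isSmooth_basePolytope_disjointSigma N hN hU
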